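/- Let $r,t\ge 1$ be fixed integers. An instance of $r$-Set Packing with $t$-Membership consists of a finite universe $\mathcal U$, a collection $\mathcal S$ of distinct subsets of $\mathcal U$, each with at most $r$ elements, and a non-negative integer $k$ (the parameter); the question is whether $\mathcal S$ contains at least $k$ sets such that each element of $\mathcal U$ belongs to at most $t$ of them. Theorem. $r$-Set Packing with $t$-Membership has a problem kernel with $O((r+1)^r k^r)$ elements from the given universe. That is, there is an algorithm that transforms every instance $(\mathcal U,\mathcal S,k)$, in time polynomial in the size of the instance (for fixed $r$ and $t$), into an instance $(\mathcal U',\mathcal S',k)$ of the same problem, with the same $k$, such that $\mathcal U'\subseteq\mathcal U$, the two instances have the same answer, and $$|\mathcal U'|\le 2\,r!\,(r+1)^r k^r ,$$ so that the constant hidden in the $O$ depends on $r$ only and not on $t$. -/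

import Mathlib

namespace SetPacking

/-! ### The problem -/

/-- An instance of `r`-Set Packing with `t`-Membership: a finite universe (its elements are named
by natural numbers), a collection of distinct subsets of it, each of size at most `r`, and a
non-negative integer `k` (the parameter). -/
structure Instance (r : ℕ) where
  univ : Finset ℕ
  sets : Finset (Finset ℕ)
  k : ℕ
  subset_univ : ∀ S ∈ sets, S ⊆ univ
  card_le : ∀ S ∈ sets, S.card ≤ r

/-- The collection contains a `(k,r,t)`-set membership: at least `k` of its sets such that each
element of the universe is in at most `t` of them. -/
def Instance.HasMembership {r : ℕ} (I : Instance r) (t : ℕ) : Prop :=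
  ∃ K : Finset (Finset ℕ), K ⊆ I.sets ∧ I.k ≤ K.card ∧
    ∀ u ∈ I.univ, (K.filter (fun S => u ∈ S)).card ≤ t

/-! ### The machine model: WHILE programs over binary trees, with a step count -/

/-- The data that programs work on: binary trees. -/
inductive Data : Type
  | nil : Data
  | cons : Data → Data → Data
  deriving DecidableEq

/-- The number of nodes of a tree. -/
def Data.size : Data → ℕ
  | .nil => 1
  | .cons a b => a.size + b.size + 1

/-- Left subtree (`nil` for `nil`). -/
def Data.head : Data → Data
  | .nil => .nil
  | .cons a _ => a

/-- Right subtree (`nil` for `nil`). -/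
def Data.tail : Data → Data
  | .nil => .nil
  | .cons _ b => b

/-- Truth values: `nil` is false; the tree with one inner node is true. -/
def Data.ofBool : Bool → Data
  | false => .nil
  | true => .cons .nil .nil

/-- The contents of the variables `0, 1, 2, …`; a program mentions only finitely many of them. -/
abbrev Store : Type := ℕ → Data

/-- Expressions. -/
inductive Expr : Type
  | var : ℕ → Expr
  | nil : Expr
  | cons : Expr → Expr → Expr
  | head : Expr → Expr
  | tail : Expr → Expr
  | eq : Expr → Expr → Expr

/-- The value of an expression. -/
def Expr.eval (s : Store) : Expr → Data
  | .var i => s i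
  | .nil => .nil
  | .cons e f => .cons (e.eval s) (f.eval s)
  | .head e => (e.eval s).head
  | .tail e => (e.eval s).tail
  | .eq e f => Data.ofBool (decide (e.eval s = f.eval s))

/-- The time for evaluating an expression. Reading a variable is charged the size of its contents
(trees are copied, not shared), so that the time for evaluating an expression is at least the size
of its value, and the time for a comparison is at least the size of the two trees compared. -/
def Expr.time (s : Store) : Expr → ℕ
  | .var i => (s i).size
  | .nil => 1
  | .cons e f => e.time s + f.time s + 1
  | .head e => e.time s + 1
  | .tail e => e.time s + 1
  | .eq e f => e.time s + f.time s + 1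

/-- Programs: assignment, composition, branching, and unbounded loops. -/
inductive Cmd : Type
  | assign : ℕ → Expr → Cmd
  | seq : Cmd → Cmd → Cmd
  | branch : Expr → Cmd → Cmd → Cmd
  | loop : Expr → Cmd → Cmd

/-- `Exec c s s' n`: started with the store `s`, the program `c` halts after `n` steps with the
store `s'`. -/
inductive Exec : Cmd → Store → Store → ℕ → Prop
  | assign (i : ℕ) (e : Expr) (s : Store) :
      Exec (.assign i e) s (Function.update s i (e.eval s)) (e.time s + 1)
  | seq {c c' : Cmd} {s s' s'' : Store} {n n' : ℕ} :
      Exec c s s' n → Exec c' s' s'' n' → Exec (.seq c c') s s'' (n + n' + 1)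
  | branch_true {e : Expr} {c c' : Cmd} {s s' : Store} {n : ℕ} :
      e.eval s ≠ .nil → Exec c s s' n → Exec (.branch e c c') s s' (e.time s + n + 1)
  | branch_false {e : Expr} {c c' : Cmd} {s s' : Store} {n : ℕ} :
      e.eval s = .nil → Exec c' s s' n → Exec (.branch e c c') s s' (e.time s + n + 1)
  | loop_false {e : Expr} {c : Cmd} {s : Store} :
      e.eval s = .nil → Exec (.loop e c) s s (e.time s + 1)
  | loop_true {e : Expr} {c : Cmd} {s s' s'' : Store} {n n' : ℕ} :
      e.eval s ≠ .nil → Exec c s s' n → Exec (.loop e c) s' s'' n' →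
        Exec (.loop e c) s s'' (e.time s + n + n' + 1)

/-- On input `d` (in variable `0`, all other variables being `nil`), the program `c` halts after
`n` steps with output `d'` (in variable `0`). -/
def Cmd.Computes (c : Cmd) (d d' : Data) (n : ℕ) : Prop :=
  ∃ s : Store, Exec c (Function.update (fun _ => Data.nil) 0 d) s n ∧ s 0 = d'

/-! ### Instances as input and output -/

/-- Lists as trees. -/
def Data.ofList : List Data → Data
  | [] => .nil
  | a :: l => .cons a (Data.ofList l)

/-- Natural numbers in binary, least significant bit first. -/
def Data.ofNat (n : ℕ) : Data :=
  Data.ofList (n.bits.map Data.ofBool)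

/-- Lists of natural numbers. -/
def Data.ofNatList (l : List ℕ) : Data :=
  Data.ofList (l.map Data.ofNat)

/-- `d` is a code of the instance `I`: it lists the elements of the universe, and the sets of the
collection (each as a list of its elements), in any order and without repetitions, followed by
`k` in binary. -/
def Instance.IsCode {r : ℕ} (I : Instance r) (d : Data) : Prop :=
  ∃ (us : List ℕ) (ss : List (List ℕ)),
    us.Nodup ∧ us.toFinset = I.univ ∧
    (∀ l ∈ ss, l.Nodup) ∧
    (ss.map List.toFinset).Nodup ∧ (ss.map List.toFinset).toFinset = I.sets ∧
    d = .cons (Data.ofNatList us)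
      (.cons (Data.ofList (ss.map Data.ofNatList)) (Data.ofNat I.k))

/-- `r`-Set Packing with `t`-Membership has a problem kernel with at most `f k` elements from the
given universe: some program transforms every instance, in time polynomial in the size of
its code, into an equivalent instance of the same problem with the same parameter, whose universe
is a part of the given one and has at most `f k` elements. (The number of sets of that instance is
then bounded by a function of `k` as well, as they are distinct subsets of the new universe.) -/
def HasKernel (r t : ℕ) (f : ℕ → ℕ) : Prop :=
  ∃ (c : Cmd) (q : Polynomial ℕ), ∀ (I : Instance r) (d : Data), I.IsCode d →
    ∃ (I' : Instance r) (d' : Data) (n : ℕ),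
      c.Computes d d' n ∧ n ≤ q.eval d.size ∧ I'.IsCode d' ∧
      (I.HasMembership t ↔ I'.HasMembership t) ∧
      I'.k = I.k ∧ I'.univ ⊆ I.univ ∧ I'.univ.card ≤ f I.k

end SetPacking

namespace SetPacking

/-! ### Functions computable in polynomial time -/

/-! Put `q = (r + 1) * k`. Go through the collection and keep a set `S` unless some `D ⊆ S` already
lies in `q ^ (r - #D)` kept sets. Every `C` then lies in at most `q ^ (r - #C)` kept sets
(`countP_keptList_le`), and every discarded set has a subset `C` attaining this bound
(`mem_keptList_or_exists`). For `C = ∅` the bound leaves at most `q ^ r` kept sets, which cover at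
most `r * q ^ r` elements; all other elements are dropped.

A solution survives by exchange (`exists_subset_of_saturated`). If it uses a discarded `S` with
saturated `C ⊆ S`, so many kept sets include `C` that one of them, different from `C`, meets the
other solution sets only inside `C`. Replacing `S` by it raises no multiplicity above `t`: on `C`
nothing grows, and its remaining elements are covered once.

For the running time, `PolyTime` carries a bound on the output size as well as on the time, so it is
closed under composition, branching and size-controlled folds. Since `k` is given in binary and
thresholds are held in unary, `k` is replaced in `q` by its minimum with the number of sets; if this
changes `k`, both instances are negative. -/

theorem eval_mono (q : Polynomial ℕ) {a b : ℕ} (h : a ≤ b) : q.eval a ≤ q.eval b := by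
  rw [Polynomial.eval_eq_sum_range, Polynomial.eval_eq_sum_range]
  gcongr

/-- The program `c` replaces the contents `d` of the variable `m` by `f d`, in time `q d.size`;
it leaves the variables below `m` alone, and may use those above `m`, whatever they contain. -/
def Implements (c : Cmd) (m : ℕ) (f : Data → Data) (q : Polynomial ℕ) : Prop :=
  ∀ s : Store, ∃ (s' : Store) (n : ℕ), Exec c s s' n ∧ n ≤ q.eval (s m).size ∧
    s' m = f (s m) ∧ ∀ i < m, s' i = s i

/-- `f` is computable in polynomial time, by programs that work above any given variable. -/
def PolyTime (f : Data → Data) : Prop :=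
  ∃ q : Polynomial ℕ, (∀ d, (f d).size ≤ q.eval d.size) ∧ ∀ m, ∃ c, Implements c m f q

namespace PolyTime

variable {f g h k : Data → Data}

theorem of_expr (e : ℕ → Expr) (a : ℕ) (he : ∀ m s, (e m).eval s = f (s m))
    (ht : ∀ m s, (e m).time s ≤ (s m).size + a) (hs : ∀ d, (f d).size ≤ d.size + a) :
    PolyTime f := by
  refine ⟨Polynomial.X + Polynomial.C (a + 1), fun d => ?_, fun m => ⟨.assign m (e m), fun s =>
    ⟨_, _, Exec.assign m (e m) s, ?_, ?_, ?_⟩⟩⟩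
  · have := hs d
    simp
    omega
  · have := ht m s
    simp
    omega
  · simp [he]
  · intro i hi
    simp [hi.ne]

protected theorem id : PolyTime fun d => d :=
  of_expr (fun m => .var m) 0 (fun _ _ => rfl) (fun _ _ => le_rfl) (fun _ => le_rfl)

theorem nil : PolyTime fun _ => .nil :=
  of_expr (fun _ => .nil) 1 (fun _ _ => rfl) (fun _ _ => by simp [Expr.time])
    (fun _ => by simp [Data.size])

theorem size_head_le (d : Data) : d.head.size ≤ d.size := by
  cases d <;> simp [Data.head, Data.size]
  omega

theorem size_tail_le (d : Data) : d.tail.size ≤ d.size := by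
  cases d <;> simp [Data.tail, Data.size]
  omega

theorem size_pos (d : Data) : 1 ≤ d.size := by
  cases d <;> simp [Data.size]

theorem comp (hf : PolyTime f) (hg : PolyTime g) : PolyTime fun d => f (g d) := by
  obtain ⟨p, hp, cf⟩ := hf
  obtain ⟨q, hq, cg⟩ := hg
  refine ⟨q + p.comp q + 1, fun d => ?_, fun m => ?_⟩
  · have := (hp (g d)).trans (eval_mono p (hq d))
    simp
    omega
  · obtain ⟨cf, hcf⟩ := cf m
    obtain ⟨cg, hcg⟩ := cg m
    refine ⟨.seq cg cf, fun s => ?_⟩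
    obtain ⟨s₁, n₁, e₁, t₁, v₁, w₁⟩ := hcg s
    obtain ⟨s₂, n₂, e₂, t₂, v₂, w₂⟩ := hcf s₁
    refine ⟨s₂, _, .seq e₁ e₂, ?_, by rw [v₂, v₁], fun i hi => by rw [w₂ i hi, w₁ i hi]⟩
    rw [v₁] at t₂
    have := t₂.trans (eval_mono p (hq (s m)))
    simp
    omega

theorem head (hf : PolyTime f) : PolyTime fun d => (f d).head :=
  comp (f := Data.head) (of_expr (fun m => .head (.var m)) 1 (fun _ _ => rfl) (fun _ _ => le_rfl)
    (fun d => (size_head_le d).trans (by omega))) hf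

theorem tail (hf : PolyTime f) : PolyTime fun d => (f d).tail :=
  comp (f := Data.tail) (of_expr (fun m => .tail (.var m)) 1 (fun _ _ => rfl) (fun _ _ => le_rfl)
    (fun d => (size_tail_le d).trans (by omega))) hf

/-- Two functions can be evaluated into fresh variables. -/
theorem exists_eval_two (hf : PolyTime f) (hg : PolyTime g) :
    ∃ q : Polynomial ℕ, (∀ d, (f d).size + (g d).size ≤ q.eval d.size) ∧ ∀ m, ∃ c, ∀ s : Store,
      ∃ (s' : Store) (n : ℕ), Exec c s s' n ∧ n ≤ q.eval (s m).size ∧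
        s' (m + 1) = f (s m) ∧ s' (m + 2) = g (s m) ∧ ∀ i ≤ m, s' i = s i := by
  obtain ⟨p, hp, cf⟩ := hf
  obtain ⟨q, hq, cg⟩ := hg
  refine ⟨p + q + 2 * Polynomial.X + 5, fun d => ?_, fun m => ?_⟩
  · have := hp d
    have := hq d
    simp
    omega
  -- The second program works above `m + 2`, so it preserves the first value in `m + 1`.
  · obtain ⟨cf, hcf⟩ := cf (m + 1)
    obtain ⟨cg, hcg⟩ := cg (m + 2)
    refine ⟨.seq (.assign (m + 1) (.var m)) (.seq cf (.seq (.assign (m + 2) (.var m)) cg)),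
      fun s => ?_⟩
    obtain ⟨s₁, n₁, e₁, t₁, v₁, w₁⟩ := hcf (Function.update s (m + 1) (s m))
    obtain ⟨s₂, n₂, e₂, t₂, v₂, w₂⟩ := hcg (Function.update s₁ (m + 2) (s₁ m))
    have h₁ : ∀ i ≤ m, s₁ i = s i := fun i hi => by
      rw [w₁ i (by omega), Function.update_of_ne (by omega)]
    rw [Function.update_self] at v₁ v₂ t₁ t₂
    rw [h₁ m le_rfl] at v₂ t₂
    refine ⟨s₂, _, .seq (.assign _ _ _) (.seq e₁ (.seq (.assign _ _ _) e₂)), ?_, ?_, v₂, ?_⟩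
    · simp [Expr.time, h₁ m le_rfl]
      omega
    · rw [w₂ _ (by omega), Function.update_of_ne (by omega), v₁]
    · intro i hi
      rw [w₂ i (by omega), Function.update_of_ne (by omega), h₁ i hi]

theorem cons (hf : PolyTime f) (hg : PolyTime g) : PolyTime fun d => .cons (f d) (g d) := by
  obtain ⟨q, hq, hc⟩ := exists_eval_two hf hg
  refine ⟨2 * q + 5, fun d => ?_, fun m => ?_⟩
  · have := hq d
    simp [Data.size]
    omega
  · obtain ⟨c, hc⟩ := hc m
    refine ⟨.seq c (.assign m (.cons (.var (m + 1)) (.var (m + 2)))), fun s => ?_⟩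
    obtain ⟨s₁, n, e, ht, v₁, v₂, w⟩ := hc s
    refine ⟨_, _, .seq e (.assign _ _ _), ?_, ?_, ?_⟩
    · have := hq (s m)
      simp [Expr.time, v₁, v₂]
      omega
    · simp [Expr.eval, v₁, v₂]
    · intro i hi
      rw [Function.update_of_ne hi.ne, w i hi.le]

theorem ite (hf : PolyTime f) (hg : PolyTime g) (hh : PolyTime h) (hk : PolyTime k) :
    PolyTime fun d => if f d = g d then h d else k d := by
  obtain ⟨q, hq, hc⟩ := exists_eval_two hf hg
  obtain ⟨p₁, hp₁, c₁⟩ := hh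
  obtain ⟨p₂, hp₂, c₂⟩ := hk
  refine ⟨2 * q + p₁ + p₂ + 3, fun d => ?_, fun m => ?_⟩
  · have := hp₁ d
    have := hp₂ d
    simp only [Polynomial.eval_add, Polynomial.eval_mul, Polynomial.eval_ofNat]
    split_ifs <;> omega
  · obtain ⟨c, hc⟩ := hc m
    obtain ⟨c₁, hc₁⟩ := c₁ m
    obtain ⟨c₂, hc₂⟩ := c₂ m
    refine ⟨.seq c (.branch (.eq (.var (m + 1)) (.var (m + 2))) c₁ c₂), fun s => ?_⟩
    obtain ⟨s₀, n, e, ht, v₁, v₂, w⟩ := hc s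
    have hw := w m le_rfl
    have hs := hq (s m)
    by_cases hfg : f (s m) = g (s m)
    · obtain ⟨s₁, n₁, e₁, t₁, z₁, w₁⟩ := hc₁ s₀
      refine ⟨s₁, _, .seq e (.branch_true ?_ e₁), ?_, ?_, ?_⟩
      · simp [Expr.eval, v₁, v₂, hfg, Data.ofBool]
      · rw [hw] at t₁
        simp [Expr.time, v₁, v₂]
        omega
      · simp [z₁, hw, hfg]
      · exact fun i hi => by rw [w₁ i hi, w i hi.le]
    · obtain ⟨s₁, n₁, e₁, t₁, z₁, w₁⟩ := hc₂ s₀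
      refine ⟨s₁, _, .seq e (.branch_false ?_ e₁), ?_, ?_, ?_⟩
      · simp [Expr.eval, v₁, v₂, hfg, Data.ofBool]
      · rw [hw] at t₁
        simp [Expr.time, v₁, v₂]
        omega
      · simp [z₁, hw, hfg]
      · exact fun i hi => by rw [w₁ i hi, w i hi.le]

theorem const (a : Data) : PolyTime fun _ => a := by
  induction a with
  | nil => exact nil
  | cons a b ha hb => exact ha.cons hb

end PolyTime

/-! ### Trees as lists -/

/-- Trees as lists. -/
def Data.toList : Data → List Data
  | .nil => []
  | .cons a b => a :: b.toList

@[simp] theorem Data.toList_nil : Data.nil.toList = [] := rfl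

@[simp] theorem Data.toList_cons (a b : Data) : (Data.cons a b).toList = a :: b.toList := rfl

@[simp] theorem Data.toList_ofList (l : List Data) : (Data.ofList l).toList = l := by
  induction l with
  | nil => rfl
  | cons a l ih => simp [Data.ofList, ih]

@[simp] theorem Data.ofList_toList (d : Data) : Data.ofList d.toList = d := by
  induction d with
  | nil => rfl
  | cons a b _ ih => simp [Data.ofList, ih]

theorem Data.size_ofList (l : List Data) :
    (Data.ofList l).size = (l.map fun a => a.size + 1).sum + 1 := by
  induction l with
  | nil => rfl
  | cons a l ih =>
    simp [Data.ofList, Data.size, ih]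
    omega

theorem Data.length_toList_le (d : Data) : d.toList.length ≤ d.size := by
  induction d with
  | nil => simp
  | cons a b _ ih =>
    simp [Data.size]
    omega

theorem Data.size_le_of_mem_toList {a d : Data} (h : a ∈ d.toList) : a.size ≤ d.size := by
  induction d with
  | nil => simp at h
  | cons b c _ ih =>
    simp only [Data.toList_cons, List.mem_cons] at h
    simp only [Data.size]
    rcases h with rfl | h
    · omega
    · have := ih h
      omega

/-! ### Polynomial-time folds over lists -/

namespace PolyTime

variable {L A : Data → Data} {g : Data → Data → Data → Data}

/-- The loop that folds over the list in the variable `m + 1`, with the result in `m + 2`. -/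
def foldLoop (m : ℕ) (c : Cmd) : Cmd :=
  .loop (.var (m + 1))
    (.seq (.assign (m + 3) (.cons (.var m) (.cons (.var (m + 2)) (.head (.var (m + 1))))))
      (.seq (.assign (m + 1) (.tail (.var (m + 1))))
        (.seq c (.assign (m + 2) (.var (m + 3))))))

/-- With `b` bounding all intermediate results and `z` the remaining list, each round has the same
cost bound: the body reads a tree of size at most `(s m).size + b + z + 2`. -/
theorem exec_loop {q : Polynomial ℕ} {m : ℕ} {c : Cmd}
    (hc : Implements c (m + 3) (fun x => g x.head x.tail.head x.tail.tail) q) (b z : ℕ) :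
    ∀ (l : Data) (s : Store), s (m + 1) = l → l.size ≤ z →
      (∀ p, p <+: l.toList → (p.foldl (g (s m)) (s (m + 2))).size ≤ b) →
      ∃ (s' : Store) (n : ℕ),
        Exec (foldLoop m c) s s' n ∧
        n ≤ (l.toList.length + 1) *
          (q.eval ((s m).size + b + z + 2) + (s m).size + 2 * b + 3 * z + 20) ∧
        s' (m + 2) = l.toList.foldl (g (s m)) (s (m + 2)) ∧ ∀ i ≤ m, s' i = s i := by
  intro l
  induction l with
  | nil =>
    intro s hs hz hb
    refine ⟨s, _, .loop_false (by simp [Expr.eval, hs]), ?_, rfl, fun _ _ => rfl⟩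
    simp [Expr.time, hs, Data.size]
  | cons a l _ ih =>
    intro s hs hz hb
    set s₁ := Function.update s (m + 3) (.cons (s m) (.cons (s (m + 2)) a)) with hs₁
    set s₂ := Function.update s₁ (m + 1) l with hs₂
    obtain ⟨s₃, n₃, e₃, t₃, v₃, w₃⟩ := hc s₂
    have h₂ : s₂ (m + 3) = .cons (s m) (.cons (s (m + 2)) a) := by simp [hs₁, hs₂]
    rw [h₂] at v₃ t₃
    have hsm : ∀ i ≤ m, s₃ i = s i := fun i hi => by
      rw [w₃ i (by omega), hs₂, Function.update_of_ne (by omega), hs₁,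
        Function.update_of_ne (by omega)]
    set s₄ := Function.update s₃ (m + 2) (s₃ (m + 3)) with hs₄
    have hsm4 : ∀ i ≤ m, s₄ i = s i := fun i hi => by
      rw [hs₄, Function.update_of_ne (by omega), hsm i hi]
    have hacc : s₄ (m + 2) = g (s m) (s (m + 2)) a := by simp [hs₄, v₃, Data.head, Data.tail]
    have hz' : a.size + l.size + 1 ≤ z := hz
    obtain ⟨s₅, n₅, e₅, t₅, v₅, w₅⟩ := ih s₄
      (by rw [hs₄, Function.update_of_ne (by omega), w₃ _ (by omega), hs₂, Function.update_self])
      (by omega)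
      -- Prefixes of the tail, started from the updated accumulator, are prefixes `a :: p` of the
      -- whole list.
      (fun p hp => by
        rw [hsm4 m le_rfl, hacc]
        exact hb (a :: p) (by simpa using hp))
    have E₁ := Exec.assign (m + 3) (.cons (.var m) (.cons (.var (m + 2)) (.head (.var (m + 1))))) s
    simp only [Expr.eval, hs, Data.head, ← hs₁] at E₁
    have h1 : s₁ (m + 1) = .cons a l := by rw [hs₁, Function.update_of_ne (by omega), hs]
    have E₂ := Exec.assign (m + 1) (.tail (.var (m + 1))) s₁
    simp only [Expr.eval, h1, Data.tail, ← hs₂] at E₂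
    have E₄ := Exec.assign (m + 2) (.var (m + 3)) s₃
    refine ⟨s₅, _, .loop_true (by simp [Expr.eval, hs]) (.seq E₁ (.seq E₂ (.seq e₃ E₄))) e₅,
      ?_, ?_, fun i hi => by rw [w₅ i hi, hsm4 i hi]⟩
    · have hb₀ : (s (m + 2)).size ≤ b := hb [] (by simp)
      have hb₁ : (g (s m) (s (m + 2)) a).size ≤ b := hb [a] (by simp)
      have h3 : s₃ (m + 3) = g (s m) (s (m + 2)) a := v₃
      rw [hsm4 m le_rfl] at t₅
      have t₃' := t₃.trans (eval_mono q (b := (s m).size + b + z + 2) (by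
        simp only [Data.size]
        omega))
      simp only [Expr.time, hs, h1, h3, Data.size, Data.toList_cons, List.length_cons] at *
      rw [add_mul _ 1]
      omega
    · rw [v₅, hsm4 m le_rfl, hacc]
      rfl

/-- Iterating a polynomial-time step can make the accumulator grow exponentially. Hence the separate
bound `B` on every partial result, not only on the last one. -/
theorem foldl (hg : PolyTime fun x => g x.head x.tail.head x.tail.tail) (hL : PolyTime L)
    (hA : PolyTime A) (B : Polynomial ℕ)
    (hB : ∀ d p, p <+: (L d).toList → (p.foldl (g d) (A d)).size ≤ B.eval d.size) :
    PolyTime fun d => (L d).toList.foldl (g d) (A d) := by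
  obtain ⟨q, hq, hc⟩ := exists_eval_two hL hA
  obtain ⟨p, hp, hcg⟩ := hg
  refine ⟨q + (q + 1) * (p.comp (Polynomial.X + B + q + 2) + Polynomial.X + 2 * B + 3 * q + 20) +
    B + 3, fun d => ?_, fun m => ?_⟩
  · have := hB d _ List.prefix_rfl
    simp only [Polynomial.eval_add]
    omega
  · obtain ⟨c, hc⟩ := hc m
    obtain ⟨cg, hcg⟩ := hcg (m + 3)
    refine ⟨.seq c (.seq (foldLoop m cg) (.assign m (.var (m + 2)))), fun s => ?_⟩
    obtain ⟨s₁, n₁, e₁, t₁, v₁, v₂, w₁⟩ := hc s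
    have hm := w₁ m le_rfl
    have hs := hq (s m)
    obtain ⟨s₂, n₂, e₂, t₂, v₃, w₂⟩ := exec_loop hcg (B.eval (s m).size) (q.eval (s m).size)
      (L (s m)) s₁ v₁ (by omega) (by
        rw [hm, v₂]
        exact hB (s m))
    rw [hm, v₂] at v₃
    rw [hm] at t₂
    refine ⟨_, _, .seq e₁ (.seq e₂ (.assign _ _ _)), ?_, ?_, ?_⟩
    · have hlen : (L (s m)).toList.length + 1 ≤ q.eval (s m).size + 1 := by
        have := (L (s m)).length_toList_le
        omega
      have t₂' := t₂.trans (Nat.mul_le_mul_right _ hlen)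
      have hB' := hB (s m) _ List.prefix_rfl
      simp only [Polynomial.eval_add, Polynomial.eval_mul, Polynomial.eval_comp, Polynomial.eval_X,
        Polynomial.eval_ofNat, Polynomial.eval_one, Expr.time, v₃]
      omega
    · simp [Expr.eval, v₃]
    · intro i hi
      rw [Function.update_of_ne hi.ne, w₂ i hi.le, w₁ i hi.le]

/-- A fold each of whose steps adds only a linear amount to the size of the result. -/
theorem foldl_of_size_le (a : ℕ) (hg : PolyTime fun x => g x.head x.tail.head x.tail.tail)
    (hL : PolyTime L) (hA : PolyTime A)
    (ha : ∀ d x y, (g d x y).size ≤ x.size + a * (d.size + y.size + 1)) :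
    PolyTime fun d => (L d).toList.foldl (g d) (A d) := by
  obtain ⟨q, hq, -⟩ := id hL
  obtain ⟨p, hp, -⟩ := id hA
  refine foldl hg hL hA (p + q * (Polynomial.C a * (Polynomial.X + q + 1))) fun d l hl => ?_
  have key : ∀ (l : List Data) (x : Data), (∀ y ∈ l, y.size ≤ q.eval d.size) →
      (l.foldl (g d) x).size ≤ x.size + l.length * (a * (d.size + q.eval d.size + 1)) := by
    intro l
    induction l with
    | nil => simp
    | cons y l ih =>
      intro x hx
      have h₁ := ih (g d x y) fun z hz => hx z (List.mem_cons_of_mem _ hz)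
      have h₂ := ha d x y
      have h₃ : a * (d.size + y.size + 1) ≤ a * (d.size + q.eval d.size + 1) := by
        have := hx y List.mem_cons_self
        gcongr
      rw [List.foldl_cons, List.length_cons, add_mul, one_mul]
      omega
  have h := key l (A d) fun y hy =>
    (Data.size_le_of_mem_toList (hl.subset hy)).trans (hq d)
  have hlen : l.length ≤ q.eval d.size :=
    hl.length_le.trans ((L d).length_toList_le.trans (hq d))
  have := Nat.mul_le_mul_right (a * (d.size + q.eval d.size + 1)) hlen
  have := hp d
  simp only [Polynomial.eval_add, Polynomial.eval_mul, Polynomial.eval_C, Polynomial.eval_X,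
    Polynomial.eval_one]
  omega

end PolyTime

end SetPacking

namespace SetPacking

open Finset

/-! ### Replacing sets of a solution by kept sets -/

/-- Every set outside `F` contains some `C` that is contained in as many sets of `F` as the bound
`q ^ (r - #C)`, respected by all `C`, allows. -/
theorem exists_subset_of_saturated {r t k : ℕ} (ht : 1 ≤ t) {𝒮 F : Finset (Finset ℕ)}
    (hF : F ⊆ 𝒮) (hr : ∀ S ∈ 𝒮, #S ≤ r)
    (hle : ∀ C : Finset ℕ, #{S ∈ F | C ⊆ S} ≤ ((r + 1) * k) ^ (r - #C))
    (hsat : ∀ S ∈ 𝒮, S ∉ F → ∃ C ⊆ S, ((r + 1) * k) ^ (r - #C) ≤ #{S' ∈ F | C ⊆ S'})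
    (K : Finset (Finset ℕ)) (hK : K ⊆ 𝒮) (hk : #K = k) (hKt : ∀ u, #{S ∈ K | u ∈ S} ≤ t) :
    ∃ K' ⊆ F, #K' = k ∧ ∀ u, #{S ∈ K' | u ∈ S} ≤ t := by
  induction hn : #(K \ F) generalizing K with
  | zero => exact ⟨K, by simpa [sdiff_eq_empty_iff_subset] using hn, hk, hKt⟩
  | succ n ih =>
    obtain ⟨S, hS⟩ : (K \ F).Nonempty := card_pos.1 (by omega)
    obtain ⟨hSK, hSF⟩ := mem_sdiff.1 hS
    obtain ⟨C, hCS, hC⟩ := hsat S (hK hSK) hSF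
    have hSr := hr S (hK hSK)
    have hkpos : 1 ≤ k := hk ▸ card_pos.2 ⟨S, hSK⟩
    -- For `#C = r` the threshold is `1`, and the set of `F` that includes `C` can only be `C = S`,
    -- which is not in `F`.
    have hCr : #C < r := by
      by_contra hcon
      have hCS' : C = S := eq_of_subset_of_card_le hCS (by omega)
      have h1 : ((r + 1) * k) ^ (r - #C) = 1 := by
        rw [Nat.sub_eq_zero_of_le (by omega), pow_zero]
      obtain ⟨S', hS'⟩ := card_pos.1 (h1 ▸ hC)
      obtain ⟨hS'F, hCS''⟩ := mem_filter.1 hS'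
      have : C = S' := eq_of_subset_of_card_le hCS'' ((hr S' (hF hS'F)).trans (by omega))
      exact hSF (hCS' ▸ this ▸ hS'F)
    set W := (K.erase S).biUnion id with hW
    have hWc : #W ≤ (k - 1) * r := by
      rw [hW, ← hk, ← card_erase_of_mem hSK]
      exact card_biUnion_le_card_mul _ _ _ fun T hT => hr T (hK (mem_of_mem_erase hT))
    -- Sets of `F` including `C` to be avoided: `C` itself, and those with an element of `W` outside
    -- `C`, at most `(k - 1) * r * Q` by the bound for the sets `insert v C`. Together they are
    -- fewer than `(r + 1) * k * Q`.
    obtain ⟨S', hS', hfree⟩ : ∃ S' ∈ F.filter (C ⊆ ·), S' ∉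
        insert C ((W \ C).biUnion fun v => F.filter (insert v C ⊆ ·)) := by
      refine exists_mem_notMem_of_card_lt_card (lt_of_lt_of_le ?_ hC)
      set Q := ((r + 1) * k) ^ (r - #C - 1) with hQ
      have hQpos : 1 ≤ Q := Nat.one_le_pow _ _ (by positivity)
      have hpow : ((r + 1) * k) ^ (r - #C) = (r + 1) * k * Q := by
        rw [hQ, ← pow_succ', Nat.sub_add_cancel (by omega)]
      have hb : #((W \ C).biUnion fun v => F.filter (insert v C ⊆ ·)) ≤ (k - 1) * r * Q := by
        refine (card_biUnion_le_card_mul _ _ Q fun v hv => ?_).trans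
          (Nat.mul_le_mul_right _ ((card_le_card sdiff_subset).trans hWc))
        have := hle (insert v C)
        rwa [card_insert_of_notMem (mem_sdiff.1 hv).2, ← Nat.sub_sub] at this
      obtain ⟨j, rfl⟩ : ∃ j, k = j + 1 := ⟨k - 1, by omega⟩
      have := card_insert_le C ((W \ C).biUnion fun v => F.filter (insert v C ⊆ ·))
      rw [hpow]
      simp only [Nat.add_sub_cancel] at hb
      nlinarith [Nat.mul_le_mul (show 1 ≤ r by omega) hQpos, Nat.zero_le (j * Q)]
    obtain ⟨hS'F, hCS'⟩ := mem_filter.1 hS'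
    rw [mem_insert, mem_biUnion, not_or] at hfree
    obtain ⟨hne, hfree⟩ := hfree
    have hdisj : ∀ v ∈ S', v ∉ C → v ∉ W := fun v hv hvC hvW =>
      hfree ⟨v, mem_sdiff.2 ⟨hvW, hvC⟩, mem_filter.2 ⟨hS'F, insert_subset hv hCS'⟩⟩
    -- As `S' ≠ C`, it has an element outside `C`; were `S'` in `K.erase S`, this element would be
    -- in `W`. So the exchange does not shrink the solution.
    have hS'K : S' ∉ K.erase S := fun hmem => by
      obtain ⟨v, hv, hvC⟩ := exists_of_ssubset (ssubset_of_subset_of_ne hCS' (Ne.symm hne))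
      exact hdisj v hv hvC (mem_biUnion.2 ⟨S', hmem, hv⟩)
    refine ih (insert S' (K.erase S)) ?_ ?_ ?_ ?_
    · exact insert_subset (hF hS'F) ((erase_subset _ _).trans hK)
    · rw [card_insert_of_notMem hS'K, card_erase_of_mem hSK]
      omega
    · intro u
      by_cases huS : u ∈ S'
      · by_cases huC : u ∈ C
        · have h1 : {T ∈ insert S' (K.erase S) | u ∈ T} =
              insert S' ({T ∈ K | u ∈ T}.erase S) := by
            rw [filter_insert, if_pos huS, filter_erase]
          have hmem : S ∈ {T ∈ K | u ∈ T} := mem_filter.2 ⟨hSK, hCS huC⟩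
          rw [h1]
          refine (card_insert_le _ _).trans ?_
          rw [card_erase_of_mem hmem, Nat.sub_add_cancel (card_pos.2 ⟨S, hmem⟩)]
          exact hKt u
        · have h1 : {T ∈ insert S' (K.erase S) | u ∈ T} ⊆ {S'} := by
            intro T hT
            obtain ⟨hT, huT⟩ := mem_filter.1 hT
            rcases mem_insert.1 hT with rfl | hT
            · simp
            · exact absurd (mem_biUnion.2 ⟨T, hT, huT⟩) (hdisj u huS huC)
          exact (card_le_card h1).trans (by simpa using ht)
      · refine (card_le_card ?_).trans (hKt u)
        rw [filter_insert, if_neg huS]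
        exact filter_subset_filter _ (erase_subset _ _)
    · have h1 : insert S' (K.erase S) \ F = (K \ F).erase S := by
        rw [insert_sdiff_of_mem _ hS'F, erase_sdiff_comm]
      rw [h1, card_erase_of_mem hS, hn, Nat.add_sub_cancel]

/-- Surplus sets can be discarded, and elements outside the universe are in no set. This is the form
in which the exchange argument applies. -/
theorem Instance.hasMembership_iff {r : ℕ} (I : Instance r) (t : ℕ) :
    I.HasMembership t ↔ ∃ K ⊆ I.sets, #K = I.k ∧ ∀ u, #{S ∈ K | u ∈ S} ≤ t := by
  constructor
  · rintro ⟨K, hK, hk, ht⟩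
    obtain ⟨K', hK', hk'⟩ := exists_subset_card_eq hk
    refine ⟨K', hK'.trans hK, hk', fun u => ?_⟩
    by_cases hu : u ∈ I.univ
    · exact (card_le_card (filter_subset_filter _ hK')).trans (ht u hu)
    · rw [filter_false_of_mem fun S hS huS => hu (I.subset_univ S (hK (hK' hS)) huS)]
      simp
  · rintro ⟨K, hK, hk, ht⟩
    exact ⟨K, hK, hk.ge, fun u _ => ht u⟩

/-- The construction gives `r` as leading factor; `r ≤ r !` suffices. -/
theorem mul_pow_le_factorial {r k : ℕ} {k' : ℕ} (h : k' ≤ k) :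
    r * ((r + 1) * k') ^ r ≤ 2 * r.factorial * ((r + 1) ^ r * k ^ r) := by
  rw [← mul_pow]
  have := r.self_le_factorial
  gcongr
  omega

end SetPacking

namespace SetPacking

/-! ### The algorithm -/

namespace Data

/-- The truth value true. -/
abbrev tt : Data := .cons .nil .nil

/-- `tt` if `a` is in the list `l`, and `nil` otherwise. -/
def mem (a l : Data) : Data :=
  l.toList.foldl (fun x b => if b = a then tt else x) nil

/-- `tt` if all entries of the list `l` are in the list `l'`, and `nil` otherwise. -/
def subset (l l' : Data) : Data :=
  l.toList.foldl (fun x a => if mem a l' = nil then nil else x) tt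

/-- The list `u` without as many entries as there are lists in `F` that include `C`. -/
def remaining (C F u : Data) : Data :=
  F.toList.foldl (fun x S => if subset C S = nil then x else x.tail) u

/-- Whether `remaining` exhausts `thr[#D]` for `C ∪ D`, where `D` is some part of the first `j`
entries of `S`. -/
def reject : ℕ → Data → Data → Data → Data → Data
  | 0, _, C, F, thr => if remaining C F thr.head = nil then tt else nil
  | j + 1, S, C, F, thr =>
    if S = nil then if remaining C F thr.head = nil then tt else nil
    else if reject j S.tail C F thr = nil then reject j S.tail (cons S.head C) F thr.tail
    else tt

/-- The sum of two numbers in unary, given as the lengths of lists. -/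
def add (u v : Data) : Data :=
  v.toList.foldl (fun x _ => cons nil x) u

/-- The product of two numbers in unary. -/
def mul (u v : Data) : Data :=
  u.toList.foldl (fun x _ => add x v) nil

/-- The list of the powers of a number in unary, from the `j`-th to the zeroth one. -/
def powers : ℕ → Data → Data
  | 0, _ => cons tt nil
  | j + 1, u => cons (mul u (powers j u).head) (powers j u)

/-- The reversed list. -/
def reverse (l : Data) : Data :=
  l.toList.foldl (fun x a => cons a x) nil

/-- The successor of a number in binary. -/
def succ (l : Data) : Data :=
  ((reverse l).toList.foldl (fun x b => cons (cons b x.head)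
    (if b = nil then cons tt x.head else cons nil x.tail)) (cons nil (cons tt nil))).tail

/-- The successor of a list of binary digits, by recursion. -/
def succList : List Data → List Data
  | [] => [tt]
  | b :: l => if b = nil then tt :: l else nil :: succList l

/-- The minimum, in unary, of the number `n`, given in binary, and the length of `l`. -/
def minLength (n l : Data) : Data :=
  (l.toList.foldl (fun x _ => if x.head = n then x else cons (succ x.head) (cons nil x.tail))
    (cons nil nil)).tail

/-- The sets that are kept. -/
def kept (r : ℕ) (thr ss : Data) : Data :=
  ss.toList.foldl (fun F S => if reject r S nil F thr = nil then cons S F else F) nil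

/-- Whether `a` is in one of the sets. -/
def memSome (a F : Data) : Data :=
  F.toList.foldl (fun x S => if mem a S = nil then x else tt) nil

/-- The elements of `us` that are in one of the sets. -/
def used (us F : Data) : Data :=
  us.toList.foldl (fun x a => if memSome a F = nil then x else cons a x) nil

/-- The thresholds for an instance. -/
def thresholds (r : ℕ) (d : Data) : Data :=
  powers r (mul (ofList (List.replicate (r + 1) nil)) (minLength d.tail.tail d.tail.head))

/-- The kernel of an instance. -/
def kernel (r : ℕ) (d : Data) : Data :=
  cons (used d.head (kept r (thresholds r d) d.tail.head))
    (cons (kept r (thresholds r d) d.tail.head) d.tail.tail)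

end Data

/-! ### Running time of the algorithm -/

namespace PolyTime

open Data

variable {f g h k : Data → Data}

theorem mem (hf : PolyTime f) (hg : PolyTime g) : PolyTime fun d => mem (f d) (g d) := by
  -- Several arguments are packed into one tree, over which the fold is a function of one variable.
  -- The constant `3` is the size of `tt`.
  have : PolyTime fun x => x.tail.toList.foldl (fun y b => if b = x.head then tt else y) .nil :=
    foldl_of_size_le (g := fun x y b => if b = x.head then tt else y) 3
      (.ite PolyTime.id.tail.tail PolyTime.id.head.head (const _) PolyTime.id.tail.head)
      PolyTime.id.tail nil fun d x y => by
        split_ifs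
        · simp only [Data.size]
          omega
        · omega
  exact this.comp (hf.cons hg)

theorem subset (hf : PolyTime f) (hg : PolyTime g) : PolyTime fun d => subset (f d) (g d) := by
  have : PolyTime fun x => x.head.toList.foldl
      (fun y a => if Data.mem a x.tail = .nil then .nil else y) tt :=
    foldl_of_size_le (g := fun x y a => if Data.mem a x.tail = .nil then .nil else y) 1
      (.ite (PolyTime.id.tail.tail.mem PolyTime.id.head.tail) nil nil PolyTime.id.tail.head)
      PolyTime.id.head (const _) fun d x y => by
        split_ifs
        · simp only [Data.size]
          omega
        · omega
  exact this.comp (hf.cons hg)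

theorem remaining (hf : PolyTime f) (hg : PolyTime g) (hh : PolyTime h) :
    PolyTime fun d => remaining (f d) (g d) (h d) := by
  have : PolyTime fun x => x.tail.head.toList.foldl
      (fun y S => if Data.subset x.head S = .nil then y else y.tail) x.tail.tail :=
    foldl_of_size_le (g := fun x y S => if Data.subset x.head S = .nil then y else y.tail) 0
      (.ite (PolyTime.id.head.head.subset PolyTime.id.tail.tail) nil PolyTime.id.tail.head
        PolyTime.id.tail.head.tail)
      PolyTime.id.tail.head PolyTime.id.tail.tail fun d x y => by
        have := size_tail_le x
        split_ifs <;> omega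
  exact this.comp (hf.cons (hg.cons hh))

/-- The recursion branches twice at each level, but its depth `j` is a constant of the program, so
it unfolds into a fixed composition. -/
theorem reject (j : ℕ) (hf : PolyTime f) (hg : PolyTime g) (hh : PolyTime h) (hk : PolyTime k) :
    PolyTime fun d => reject j (f d) (g d) (h d) (k d) := by
  induction j generalizing f g k with
  | zero => exact .ite (hg.remaining hh hk.head) nil (const _) nil
  | succ j ih =>
    exact .ite hf nil (.ite (hg.remaining hh hk.head) nil (const _) nil)
      (.ite (ih hf.tail hg hk) nil (ih hf.tail (hf.head.cons hg) hk.tail) (const _))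

theorem add (hf : PolyTime f) (hg : PolyTime g) : PolyTime fun d => add (f d) (g d) := by
  have : PolyTime fun x => x.tail.toList.foldl (fun y _ => .cons .nil y) x.head :=
    foldl_of_size_le (g := fun _ y _ => .cons .nil y) 2 (nil.cons PolyTime.id.tail.head)
      PolyTime.id.tail PolyTime.id.head fun d x y => by
        simp only [Data.size]
        omega
  exact this.comp (hf.cons hg)

theorem size_add_le (u v : Data) : (Data.add u v).size ≤ u.size + 2 * v.size := by
  have : ∀ (l : List Data) (u : Data),
      (l.foldl (fun x _ => Data.cons .nil x) u).size = u.size + 2 * l.length := by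
    intro l
    induction l with
    | nil => simp
    | cons a l ih =>
      intro u
      simp only [List.foldl_cons, ih, Data.size, List.length_cons]
      omega
  have h := v.length_toList_le
  rw [Data.add, this]
  omega

theorem mul (hf : PolyTime f) (hg : PolyTime g) : PolyTime fun d => mul (f d) (g d) := by
  have : PolyTime fun x => x.head.toList.foldl (fun y _ => Data.add y x.tail) .nil :=
    foldl_of_size_le (g := fun x y _ => Data.add y x.tail) 2
      (PolyTime.id.tail.head.add PolyTime.id.head.tail) PolyTime.id.head nil fun d x y => by
        have := size_add_le x d.tail
        have := size_tail_le d
        omega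
  exact this.comp (hf.cons hg)

theorem powers (j : ℕ) (hf : PolyTime f) : PolyTime fun d => powers j (f d) := by
  induction j with
  | zero => exact const _
  | succ j ih => exact (hf.mul ih.head).cons ih

theorem reverse (hf : PolyTime f) : PolyTime fun d => reverse (f d) := by
  have : PolyTime fun x => x.toList.foldl (fun y a => .cons a y) .nil :=
    foldl_of_size_le (g := fun _ y a => .cons a y) 1
      (PolyTime.id.tail.tail.cons PolyTime.id.tail.head) PolyTime.id nil fun d x y => by
        simp only [Data.size]
        omega
  exact this.comp hf

theorem size_head_add_size_tail_le (x : Data) : x.head.size + x.tail.size ≤ x.size + 1 := by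
  cases x <;> simp [Data.head, Data.tail, Data.size]
  omega


/-- Incrementing `b :: l` needs both `l` and its successor. The fold therefore reads the most
significant digit first and carries this pair. -/
theorem foldl_succ (l : List Data) :
    l.foldl (fun x b => Data.cons (.cons b x.head)
      (if b = .nil then .cons tt x.head else .cons .nil x.tail)) (.cons .nil (.cons tt .nil)) =
      .cons (ofList l.reverse) (ofList (succList l.reverse)) := by
  rw [← l.reverse_reverse, List.foldl_reverse, List.reverse_reverse]
  induction l.reverse with
  | nil => rfl
  | cons b l ih =>
    rw [List.foldr_cons, ih]
    simp only [Data.head, Data.tail, succList]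
    split_ifs <;> rfl

theorem size_succList_le (l : List Data) : (ofList (succList l)).size ≤ (ofList l).size + 4 := by
  induction l with
  | nil => simp [succList, ofList, Data.size]
  | cons b l ih =>
    simp only [succList]
    have := size_pos b
    split_ifs <;> simp only [ofList, Data.size] <;> omega

theorem toList_reverse (d : Data) : (Data.reverse d).toList = d.toList.reverse := by
  have : ∀ (l : List Data) (x : Data),
      (l.foldl (fun x a => Data.cons a x) x).toList = l.reverse ++ x.toList := by
    intro l
    induction l with
    | nil => simp
    | cons a l ih => simp [ih]
  simpa [Data.reverse] using this d.toList .nil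

theorem succ_eq (d : Data) : Data.succ d = ofList (succList d.toList) := by
  rw [Data.succ, foldl_succ, toList_reverse, List.reverse_reverse]
  rfl

theorem size_succ_le (d : Data) : (Data.succ d).size ≤ d.size + 4 := by
  simpa [succ_eq] using size_succList_le d.toList

theorem succ (hf : PolyTime f) : PolyTime fun d => succ (f d) := by
  have : PolyTime fun x => (Data.reverse x).toList.foldl (fun x b => .cons (.cons b x.head)
      (if b = .nil then .cons tt x.head else .cons .nil x.tail)) (.cons .nil (.cons tt .nil)) := by
    -- A step may copy `x.head` into the second component, so no step-by-step linear growth bound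
    -- applies; the closed form of the partial results gives `2 * X + 5`.
    refine foldl (g := fun _ x b => .cons (.cons b x.head)
      (if b = .nil then .cons tt x.head else .cons .nil x.tail)) ?_ PolyTime.id.reverse
      (const _) (2 * Polynomial.X + 5) fun d p hp => ?_
    · exact (PolyTime.id.tail.tail.cons PolyTime.id.tail.head.head).cons
        (.ite PolyTime.id.tail.tail nil ((const _).cons PolyTime.id.tail.head.head)
          (nil.cons PolyTime.id.tail.head.tail))
    · rw [foldl_succ]
      rw [toList_reverse] at hp
      have h₁ := size_succList_le p.reverse
      have h₂ : (ofList p.reverse).size ≤ d.size := by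
        rw [← ofList_toList d, size_ofList, size_ofList, List.map_reverse, List.sum_reverse]
        obtain ⟨p', hp'⟩ := hp
        have h₃ := congrArg List.reverse hp'
        rw [List.reverse_reverse] at h₃
        rw [← h₃]
        simp
      simp only [Data.size, Polynomial.eval_add, Polynomial.eval_mul, Polynomial.eval_X,
        Polynomial.eval_ofNat]
      omega
  exact this.tail.comp hf

/-- Counting stops at the length of the list, so the unary result stays small even if the binary
number is exponentially large. -/
theorem minLength (hf : PolyTime f) (hg : PolyTime g) :
    PolyTime fun d => minLength (f d) (g d) := by
  have : PolyTime fun d => d.tail.toList.foldl (fun x _ => if x.head = d.head then x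
      else .cons (Data.succ x.head) (.cons .nil x.tail)) (.cons .nil .nil) :=
    foldl_of_size_le (g := fun d x _ => if x.head = d.head then x
      else .cons (Data.succ x.head) (.cons .nil x.tail)) 8
      (.ite PolyTime.id.tail.head.head PolyTime.id.head.head PolyTime.id.tail.head
        (PolyTime.id.tail.head.head.succ.cons (nil.cons PolyTime.id.tail.head.tail)))
      PolyTime.id.tail (const _) fun d x y => by
        have := size_succ_le x.head
        have := size_head_add_size_tail_le x
        split_ifs
        · omega
        · simp only [Data.size]
          omega
  exact this.tail.comp (hf.cons hg)

theorem kept (r : ℕ) (hf : PolyTime f) (hg : PolyTime g) :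
    PolyTime fun d => kept r (f d) (g d) := by
  have : PolyTime fun d => d.tail.toList.foldl
      (fun F S => if Data.reject r S .nil F d.head = .nil then .cons S F else F) .nil :=
    foldl_of_size_le (g := fun d F S => if Data.reject r S .nil F d.head = .nil then .cons S F
      else F) 1
      (.ite (reject r PolyTime.id.tail.tail nil PolyTime.id.tail.head PolyTime.id.head.head) nil
        (PolyTime.id.tail.tail.cons PolyTime.id.tail.head) PolyTime.id.tail.head)
      PolyTime.id.tail nil fun d x y => by
        split_ifs
        · simp only [Data.size]
          omega
        · omega
  exact this.comp (hf.cons hg)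

theorem memSome (hf : PolyTime f) (hg : PolyTime g) : PolyTime fun d => memSome (f d) (g d) := by
  have : PolyTime fun d => d.tail.toList.foldl
      (fun x S => if Data.mem d.head S = .nil then x else tt) .nil :=
    foldl_of_size_le (g := fun d x S => if Data.mem d.head S = .nil then x else tt) 3
      (.ite (PolyTime.id.head.head.mem PolyTime.id.tail.tail) nil PolyTime.id.tail.head (const _))
      PolyTime.id.tail nil fun d x y => by
        split_ifs
        · omega
        · simp only [Data.size]
          omega
  exact this.comp (hf.cons hg)

theorem used (hf : PolyTime f) (hg : PolyTime g) : PolyTime fun d => used (f d) (g d) := by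
  have : PolyTime fun d => d.head.toList.foldl
      (fun x a => if Data.memSome a d.tail = .nil then x else .cons a x) .nil :=
    foldl_of_size_le (g := fun d x a => if Data.memSome a d.tail = .nil then x else .cons a x) 1
      (.ite (PolyTime.id.tail.tail.memSome PolyTime.id.head.tail) nil PolyTime.id.tail.head
        (PolyTime.id.tail.tail.cons PolyTime.id.tail.head))
      PolyTime.id.head nil fun d x y => by
        split_ifs
        · omega
        · simp only [Data.size]
          omega
  exact this.comp (hf.cons hg)

theorem kernel (r : ℕ) : PolyTime (kernel r) := by
  have h : PolyTime fun d => Data.kept r (thresholds r d) d.tail.head :=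
    .kept r (.powers r ((const _).mul (PolyTime.id.tail.tail.minLength PolyTime.id.tail.head)))
      PolyTime.id.tail.head
  exact (PolyTime.id.head.used h).cons (h.cons PolyTime.id.tail.tail)

end PolyTime
end SetPacking

namespace SetPacking

/-! ### What the algorithm computes -/

namespace Data

@[simp] theorem head_cons (a b : Data) : (cons a b).head = a := rfl

@[simp] theorem tail_cons (a b : Data) : (cons a b).tail = b := rfl

theorem mem_eq_nil_iff (a l : Data) : mem a l = nil ↔ a ∉ l.toList := by
  have : ∀ (l : List Data) (x : Data),
      l.foldl (fun x b => if b = a then tt else x) x = if a ∈ l then tt else x := by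
    intro l
    induction l with
    | nil => simp
    | cons b l ih =>
      intro x
      simp only [List.foldl_cons, ih, List.mem_cons]
      split_ifs <;> simp_all
  rw [mem, this]
  split_ifs <;> simp_all

theorem subset_eq_nil_iff (l l' : Data) : subset l l' = nil ↔ ¬ ∀ a ∈ l.toList, a ∈ l'.toList := by
  have : ∀ (l : List Data) (x : Data), l.foldl (fun x a => if mem a l' = nil then nil else x) x =
      if ∀ a ∈ l, a ∈ l'.toList then x else nil := by
    intro l
    induction l with
    | nil => simp
    | cons b l ih =>
      intro x
      rw [List.foldl_cons, ih]
      simp only [List.forall_mem_cons, mem_eq_nil_iff]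
      by_cases h₁ : b ∈ l'.toList <;> simp [h₁]
  rw [subset, this]
  split_ifs <;> simp_all

theorem toList_eq_nil {d : Data} : d.toList = [] ↔ d = nil := by
  cases d <;> simp

theorem toList_tail (d : Data) : d.tail.toList = d.toList.tail := by
  cases d <;> rfl

/-- `u` is a unary counter that loses one entry for each list of `F` including `C`. -/
theorem remaining_eq_nil_iff (C F u : Data) : remaining C F u = nil ↔
    u.toList.length ≤ F.toList.countP fun S => ∀ a ∈ C.toList, a ∈ S.toList := by
  have : ∀ (F : List Data) (u : Data),
      (F.foldl (fun x S => if subset C S = nil then x else x.tail) u).toList =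
      u.toList.drop (F.countP fun S => ∀ a ∈ C.toList, a ∈ S.toList) := by
    intro F
    induction F with
    | nil => simp
    | cons S F ih =>
      intro u
      rw [List.foldl_cons, ih, List.countP_cons]
      simp only [subset_eq_nil_iff, decide_eq_true_eq]
      by_cases h : ∀ a ∈ C.toList, a ∈ S.toList
      · rw [if_neg (not_not.2 h), if_pos h, toList_tail, ← List.drop_one, List.drop_drop, add_comm]
      · rw [if_pos h, if_neg h, add_zero]
  rw [← toList_eq_nil, remaining, this, List.drop_eq_nil_iff]

theorem length_add (u v : Data) :
    (add u v).toList.length = u.toList.length + v.toList.length := by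
  have : ∀ (l : List Data) (u : Data),
      (l.foldl (fun x _ => cons nil x) u).toList.length = u.toList.length + l.length := by
    intro l
    induction l with
    | nil => simp
    | cons a l ih =>
      intro u
      simp only [List.foldl_cons, ih, toList_cons, List.length_cons]
      omega
  exact this _ _

theorem length_mul (u v : Data) :
    (mul u v).toList.length = u.toList.length * v.toList.length := by
  have : ∀ (l : List Data) (x : Data), (l.foldl (fun x _ => add x v) x).toList.length =
      x.toList.length + l.length * v.toList.length := by
    intro l
    induction l with
    | nil => simp
    | cons a l ih =>
      intro u
      simp only [List.foldl_cons, ih, length_add, List.length_cons]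
      ring
  simpa [mul] using this u.toList nil

/-- This is the entry that `reject` reads after `i` tails, that is, after `i` elements have been
chosen for `D`. -/
theorem length_powers (u : Data) {i j : ℕ} (h : i ≤ j) :
    (ofList ((powers j u).toList.drop i)).head.toList.length = u.toList.length ^ (j - i) := by
  induction j generalizing i with
  | zero =>
    obtain rfl : i = 0 := by omega
    rfl
  | succ j ih =>
    cases i with
    | zero =>
      have := ih (Nat.zero_le _)
      simp only [List.drop_zero, ofList_toList, Nat.sub_zero] at this ⊢
      rw [powers, head_cons, length_mul, this, pow_succ']
    | succ i =>
      rw [powers, toList_cons, List.drop_succ_cons, ih (by omega), Nat.add_sub_add_right]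

theorem succ_ofNat (n : ℕ) : succ (ofNat n) = ofNat (n + 1) := by
  rw [PolyTime.succ_eq, ofNat, toList_ofList, ofNat]
  congr 1
  induction n using Nat.strong_induction_on with
  | _ n ih =>
    rcases Nat.even_or_odd' n with ⟨m, rfl | rfl⟩
    · rcases Nat.eq_zero_or_pos m with rfl | hm
      · simp [succList, ofBool]
      · rw [Nat.bit0_bits m hm.ne', Nat.bit1_bits]
        simp [succList, ofBool]
    · rw [Nat.bit1_bits, show 2 * m + 1 + 1 = 2 * (m + 1) by ring, Nat.bit0_bits _ (by omega)]
      simp [succList, ofBool, ih m (by omega)]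

theorem ofList_injective : Function.Injective ofList :=
  Function.LeftInverse.injective toList_ofList

theorem ofNat_injective : Function.Injective ofNat := by
  intro a b h
  have hb : Function.Injective ofBool := by decide
  have h := List.map_injective_iff.2 hb (ofList_injective h)
  rw [← Nat.digits_inj_iff (b := 2), Nat.digits_two_eq_bits, Nat.digits_two_eq_bits, h]

theorem length_minLength (k : ℕ) (l : Data) :
    (minLength (ofNat k) l).toList.length = min k l.toList.length := by
  -- Invariant: the accumulator holds the same `i` in binary and in unary, and stays put once `i =
  -- k`.
  have : ∀ (l : List Data) (i : ℕ), i ≤ k →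
      l.foldl (fun x _ => if x.head = ofNat k then x else cons (succ x.head) (cons nil x.tail))
        (cons (ofNat i) (ofList (List.replicate i nil))) =
      cons (ofNat (min k (i + l.length))) (ofList (List.replicate (min k (i + l.length)) nil)) := by
    intro l
    induction l with
    | nil =>
      intro i hi
      simp [hi]
    | cons a l ih =>
      intro i hi
      rw [List.foldl_cons]
      simp only [head_cons, tail_cons, ofNat_injective.eq_iff]
      by_cases hik : i = k
      · rw [if_pos hik, ih i hi, List.length_cons]
        congr 2 <;> [skip; congr 1] <;> omega
      · rw [if_neg hik, succ_ofNat]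
        have := ih (i + 1) (by omega)
        rw [List.length_cons, ← add_assoc, add_right_comm]
        exact this
  have h := this l.toList 0 (Nat.zero_le k)
  rw [minLength]
  have h0 : ofNat 0 = nil := by simp [ofNat, ofList]
  simp only [h0, List.replicate_zero, ofList] at h
  rw [h]
  simp

end Data
end SetPacking

/-! ### The greedy selection on lists of numbers, and the kernel -/

namespace SetPacking

open Finset

namespace Data

theorem mem_ofNatList (a : ℕ) (l : List ℕ) : ofNat a ∈ (ofNatList l).toList ↔ a ∈ l := by
  rw [ofNatList, toList_ofList, List.mem_map_of_injective ofNat_injective]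

theorem remaining_ofNatList_eq_nil_iff (C : List ℕ) (F : List (List ℕ)) (u : Data) :
    remaining (ofNatList C) (ofList (F.map ofNatList)) u = nil ↔
      u.toList.length ≤ F.countP fun S => C.toFinset ⊆ S.toFinset := by
  rw [remaining_eq_nil_iff, toList_ofList, List.countP_map]
  have : ((fun S : Data => decide (∀ a ∈ (ofNatList C).toList, a ∈ S.toList)) ∘ ofNatList) =
      fun S : List ℕ => decide (C.toFinset ⊆ S.toFinset) := by
    funext S
    simp only [Function.comp_apply, decide_eq_decide, subset_iff, List.mem_toFinset]
    rw [ofNatList, toList_ofList, List.forall_mem_map]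
    simp only [mem_ofNatList]
  rw [this]

theorem ofNatList_cons (a : ℕ) (l : List ℕ) :
    ofNatList (a :: l) = cons (ofNat a) (ofNatList l) := rfl

/-- The two recursive calls correspond to the sublists that skip the first entry and those that use
it; the latter move it into `C` and advance the thresholds by one. -/
theorem reject_eq_nil_iff (j : ℕ) (S C : List ℕ) (F : List (List ℕ)) (th : List Data)
    (hS : S.length ≤ j) :
    reject j (ofNatList S) (ofNatList C) (ofList (F.map ofNatList)) (ofList th) = nil ↔
      ∀ l : List ℕ, l.Sublist S → F.countP (fun T => l.toFinset ∪ C.toFinset ⊆ T.toFinset) <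
        (ofList (th.drop l.length)).head.toList.length := by
  induction j generalizing S C th with
  | zero =>
    obtain rfl : S = [] := List.eq_nil_of_length_eq_zero (by omega)
    simp [reject, remaining_ofNatList_eq_nil_iff]
  | succ j ih =>
    cases S with
    | nil =>
      rw [reject, if_pos (show ofNatList [] = nil from rfl)]
      simp [remaining_ofNatList_eq_nil_iff]
    | cons a S =>
      have hth : (ofList th).tail = ofList (th.drop 1) := by cases th <;> rfl
      have hS' : S.length ≤ j := by simpa using hS
      rw [reject, if_neg (by simp [ofNatList_cons]), ofNatList_cons, tail_cons, head_cons,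
        ← ofNatList_cons, hth]
      have h₁ := ih S C th hS'
      have h₂ := ih S (a :: C) (th.drop 1) hS'
      have key : (∀ l : List ℕ, l.Sublist (a :: S) →
          F.countP (fun T => l.toFinset ∪ C.toFinset ⊆ T.toFinset) <
          (ofList (th.drop l.length)).head.toList.length) ↔
          (∀ l : List ℕ, l.Sublist S → F.countP (fun T => l.toFinset ∪ C.toFinset ⊆ T.toFinset) <
          (ofList (th.drop l.length)).head.toList.length) ∧
          ∀ l : List ℕ, l.Sublist S → F.countP (fun T => l.toFinset ∪ (a :: C).toFinset ⊆ T.toFinset) <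
          (ofList ((th.drop 1).drop l.length)).head.toList.length := by
        simp only [List.sublist_cons_iff, or_imp, forall_and]
        refine and_congr_right fun _ => ⟨fun h l hl => ?_, ?_⟩
        · simpa [insert_union, union_insert, add_comm] using h (a :: l) ⟨l, rfl, hl⟩
        · rintro h _ ⟨l, rfl, hl⟩
          simpa [insert_union, union_insert, add_comm] using h l hl
      rw [key, ← h₁, ← h₂]
      split_ifs with h <;> simp [h]

theorem memSome_ofNat_eq_nil_iff (a : ℕ) (F : List (List ℕ)) :
    memSome (ofNat a) (ofList (F.map ofNatList)) = nil ↔ ∀ S ∈ F, a ∉ S := by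
  have : ∀ (F : List (List ℕ)) (x : Data), (F.map ofNatList).foldl
      (fun x S => if mem (ofNat a) S = nil then x else tt) x =
      if ∀ S ∈ F, a ∉ S then x else tt := by
    intro F
    induction F with
    | nil => simp
    | cons S F ih =>
      intro x
      rw [List.map_cons, List.foldl_cons, ih]
      simp only [List.forall_mem_cons, mem_eq_nil_iff, mem_ofNatList]
      by_cases h₁ : a ∈ S <;> simp [h₁]
  rw [memSome, toList_ofList, this]
  split_ifs with h
  · exact iff_of_true rfl h
  · exact iff_of_false (by simp) h

theorem used_ofNatList (us : List ℕ) (F : List (List ℕ)) :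
    used (ofNatList us) (ofList (F.map ofNatList)) =
      ofNatList (us.filter fun a => ∃ S ∈ F, a ∈ S).reverse := by
  have : ∀ us l : List ℕ, (us.map ofNat).foldl
      (fun x a => if memSome a (ofList (F.map ofNatList)) = nil then x else cons a x)
      (ofNatList l) = ofNatList ((us.filter fun a => ∃ S ∈ F, a ∈ S).reverse ++ l) := by
    intro us
    induction us with
    | nil => simp
    | cons a us ih =>
      intro l
      rw [List.map_cons, List.foldl_cons, List.filter_cons]
      simp only [memSome_ofNat_eq_nil_iff]
      by_cases h : ∀ S ∈ F, a ∉ S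
      · have h' : ¬ ∃ S ∈ F, a ∈ S := by simpa using h
        rw [if_pos h, if_neg (by simpa using h), ih]
      · have h' : ∃ S ∈ F, a ∈ S := by simpa using h
        rw [if_neg h, if_pos (by simpa using h'), ← ofNatList_cons, ih]
        simp
  have h := this us []
  rw [List.append_nil] at h
  rw [used, ofNatList, toList_ofList]
  exact h

end Data

/-- The sets that the greedy procedure keeps: `S` is added unless some `D ⊆ S` is contained in
`q ^ (r - #D)` sets already. -/
def keptList (r q : ℕ) (ss F : List (List ℕ)) : List (List ℕ) :=
  ss.foldl (fun F S => if ∃ D ⊆ S.toFinset, q ^ (r - #D) ≤ F.countP (D ⊆ ·.toFinset) then F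
    else S :: F) F

/-- `reject` runs over sublists, `keptList` over subsets. As the lists have no repetitions, each
subset comes from a sublist of length equal to its cardinality. -/
theorem kept_eq {r q : ℕ} {thr : Data}
    (hthr : ∀ i ≤ r, (Data.ofList (thr.toList.drop i)).head.toList.length = q ^ (r - i))
    {ss : List (List ℕ)} (hss : ∀ S ∈ ss, S.Nodup) (hr : ∀ S ∈ ss, S.length ≤ r) :
    Data.kept r thr (Data.ofList (ss.map Data.ofNatList)) =
      Data.ofList ((keptList r q ss []).map Data.ofNatList) := by
  have : ∀ (ss F : List (List ℕ)), (∀ S ∈ ss, S.Nodup) → (∀ S ∈ ss, S.length ≤ r) →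
      (ss.map Data.ofNatList).foldl
        (fun F S => if Data.reject r S .nil F thr = .nil then .cons S F else F)
        (Data.ofList (F.map Data.ofNatList)) =
      Data.ofList ((keptList r q ss F).map Data.ofNatList) := by
    intro ss
    induction ss with
    | nil => intros; rfl
    | cons S ss ih =>
      intro F hss hr
      rw [List.forall_mem_cons] at hss hr
      have h := Data.reject_eq_nil_iff r S [] F thr.toList hr.1
      rw [Data.ofList_toList, show Data.ofNatList [] = .nil from rfl] at h
      have h' : (∀ l : List ℕ, l.Sublist S →
          F.countP (fun T => l.toFinset ∪ ([] : List ℕ).toFinset ⊆ T.toFinset) <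
          (Data.ofList (thr.toList.drop l.length)).head.toList.length) ↔
          ¬ ∃ D ⊆ S.toFinset, q ^ (r - #D) ≤ F.countP (D ⊆ ·.toFinset) := by
        push Not
        constructor
        · intro hl D hD
          have hfin : (S.filter (· ∈ D)).toFinset = D := by
            ext a
            simp only [List.toFinset_filter, decide_eq_true_eq, mem_filter, List.mem_toFinset]
            exact ⟨fun h => h.2, fun h => ⟨List.mem_toFinset.1 (hD h), h⟩⟩
          have hlen : (S.filter (· ∈ D)).length = #D := by
            rw [← List.toFinset_card_of_nodup (hss.1.filter _), hfin]
          have := hl (S.filter (· ∈ D)) List.filter_sublist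
          rw [hthr _ (List.length_filter_le _ _ |>.trans hr.1), hfin, hlen] at this
          simpa using this
        · intro hD l hl
          have := hD l.toFinset fun a ha => List.mem_toFinset.2 (hl.subset (List.mem_toFinset.1 ha))
          rw [List.toFinset_card_of_nodup (hl.nodup hss.1)] at this
          rw [hthr _ (hl.length_le.trans hr.1)]
          simpa using this
      rw [h'] at h
      rw [List.map_cons, List.foldl_cons, keptList, List.foldl_cons]
      by_cases hex : ∃ D ⊆ S.toFinset, q ^ (r - #D) ≤ F.countP (D ⊆ ·.toFinset)
      · rw [if_neg (by rwa [h, not_not]), if_pos hex]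
        exact ih F hss.2 hr.2
      · rw [if_pos (h.2 hex), if_neg hex]
        exact ih (S :: F) hss.2 hr.2
  rw [Data.kept, Data.toList_ofList]
  exact this ss [] hss hr

theorem keptList_sublist (r q : ℕ) (ss F : List (List ℕ)) :
    (keptList r q ss F).Sublist (ss.reverse ++ F) := by
  induction ss generalizing F with
  | nil => exact List.Sublist.refl _
  | cons S ss ih =>
    rw [keptList, List.foldl_cons, List.reverse_cons, List.append_assoc]
    refine (ih _).trans (List.Sublist.append (List.Sublist.refl _) ?_)
    split_ifs
    · exact List.sublist_cons_self _ _
    · exact List.Sublist.refl _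

theorem sublist_keptList (r q : ℕ) (ss F : List (List ℕ)) :
    F.Sublist (keptList r q ss F) := by
  induction ss generalizing F with
  | nil => exact List.Sublist.refl _
  | cons S ss ih =>
    rw [keptList, List.foldl_cons]
    refine List.Sublist.trans ?_ (ih _)
    split_ifs
    · exact List.Sublist.refl _
    · exact List.sublist_cons_self _ _

/-- A set including `C` is added only while the count for `C` is strictly below the threshold. -/
theorem countP_keptList_le {r q : ℕ} (ss F : List (List ℕ)) (C : Finset ℕ)
    (hF : F.countP (C ⊆ ·.toFinset) ≤ q ^ (r - #C)) :
    (keptList r q ss F).countP (C ⊆ ·.toFinset) ≤ q ^ (r - #C) := by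
  induction ss generalizing F with
  | nil => exact hF
  | cons S ss ih =>
    rw [keptList, List.foldl_cons]
    refine ih _ ?_
    split_ifs with h
    · exact hF
    · rw [List.countP_cons]
      split_ifs with hC
      · push Not at h
        exact h C (by simpa using hC)
      · exact hF

/-- A rejected set has a saturated subset at that moment, and it stays saturated because the kept
list only grows. -/
theorem mem_keptList_or_exists {r q : ℕ} {ss : List (List ℕ)} (F : List (List ℕ)) {S : List ℕ}
    (hS : S ∈ ss) : S ∈ keptList r q ss F ∨
      ∃ C ⊆ S.toFinset, q ^ (r - #C) ≤ (keptList r q ss F).countP (C ⊆ ·.toFinset) := by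
  induction ss generalizing F with
  | nil => simp at hS
  | cons T ss ih =>
    rcases List.mem_cons.1 hS with rfl | hS
    · rw [keptList, List.foldl_cons]
      split_ifs with h
      · obtain ⟨C, hC, hle⟩ := h
        exact .inr ⟨C, hC, hle.trans (sublist_keptList r q ss F).countP_le⟩
      · exact .inl ((sublist_keptList r q ss (S :: F)).subset List.mem_cons_self)
    · exact ih _ hS

theorem countP_eq_card_filter {F : List (List ℕ)} (hF : (F.map List.toFinset).Nodup)
    (C : Finset ℕ) :
    F.countP (C ⊆ ·.toFinset) = #{S ∈ (F.map List.toFinset).toFinset | C ⊆ S} := by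
  have : {S ∈ (F.map List.toFinset).toFinset | C ⊆ S} =
      ((F.map List.toFinset).filter (C ⊆ ·)).toFinset := by
    rw [List.toFinset_filter]
    simp
  rw [this, List.toFinset_card_of_nodup (hF.filter _), ← List.countP_eq_length_filter,
    List.countP_map]
  rfl

theorem hasKernel (r t : ℕ) (ht : 1 ≤ t) :
    HasKernel r t (fun k => 2 * Nat.factorial r * ((r + 1) ^ r * k ^ r)) := by
  obtain ⟨p, -, hc⟩ := PolyTime.kernel r
  obtain ⟨c, hc⟩ := hc 0
  refine ⟨c, p, fun I d => ?_⟩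
  rintro ⟨us, ss, hus, husI, hssn, hssd, hssI, hd⟩
  obtain ⟨s, n, he, hn, hs, -⟩ := hc (Function.update (fun _ => Data.nil) 0 d)
  rw [Function.update_self] at hn hs
  have hmem : ∀ S ∈ ss, S.toFinset ∈ I.sets := fun S hS => by
    rw [← hssI, List.mem_toFinset]
    exact List.mem_map_of_mem hS
  have hlen : ∀ S ∈ ss, S.length ≤ r := fun S hS => by
    rw [← List.toFinset_card_of_nodup (hssn S hS)]
    exact I.card_le _ (hmem S hS)
  set k' := min I.k ss.length with hk'
  set R := keptList r ((r + 1) * k') ss [] with hR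
  have hRss : ∀ S ∈ R, S ∈ ss := fun S hS => by
    simpa using (keptList_sublist r ((r + 1) * k') ss []).subset hS
  have hRn : (R.map List.toFinset).Nodup := by
    have h := (keptList_sublist r ((r + 1) * k') ss []).map List.toFinset
    rw [List.append_nil, List.map_reverse] at h
    exact h.nodup (List.nodup_reverse.2 hssd)
  set F := (R.map List.toFinset).toFinset with hF
  have hFI : F ⊆ I.sets := fun S hS => by
    rw [hF, List.mem_toFinset] at hS
    obtain ⟨T, hT, rfl⟩ := List.mem_map.1 hS
    exact hmem T (hRss T hT)
  have hle : ∀ C : Finset ℕ, #{S ∈ F | C ⊆ S} ≤ ((r + 1) * k') ^ (r - #C) := fun C => by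
    rw [← countP_eq_card_filter hRn]
    exact countP_keptList_le ss [] C (by simp)
  have hsat : ∀ S ∈ I.sets, S ∉ F →
      ∃ C ⊆ S, ((r + 1) * k') ^ (r - #C) ≤ #{S' ∈ F | C ⊆ S'} := by
    intro S hS hSF
    rw [← hssI, List.mem_toFinset] at hS
    obtain ⟨T, hT, rfl⟩ := List.mem_map.1 hS
    rcases mem_keptList_or_exists (r := r) (q := (r + 1) * k') [] hT with h | ⟨C, hC, h⟩
    · refine absurd ?_ hSF
      rw [hF, List.mem_toFinset]
      exact List.mem_map_of_mem h
    · exact ⟨C, hC, by rwa [← countP_eq_card_filter hRn]⟩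
  have hU : ∀ {a}, a ∈ us.filter (fun a => ∃ S ∈ R, a ∈ S) ↔ ∃ S ∈ F, a ∈ S := by
    intro a
    have h1 : (∃ S ∈ F, a ∈ S) ↔ ∃ S ∈ R, a ∈ S := by simp [hF]
    rw [h1, List.mem_filter, decide_eq_true_eq]
    refine ⟨fun h => h.2, fun h => ⟨?_, h⟩⟩
    obtain ⟨S, hS, ha⟩ := h
    rw [← List.mem_toFinset, husI]
    exact I.subset_univ _ (hmem S (hRss S hS)) (List.mem_toFinset.2 ha)
  have hkern : Data.kernel r d =
      .cons (Data.ofNatList (us.filter fun a => ∃ S ∈ R, a ∈ S).reverse)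
        (.cons (Data.ofList (R.map Data.ofNatList)) (Data.ofNat I.k)) := by
    have hkept : Data.kept r (Data.thresholds r d) d.tail.head =
        Data.ofList (R.map Data.ofNatList) := by
      rw [hd, Data.tail_cons, Data.head_cons]
      refine kept_eq (fun i hi => ?_) hssn hlen
      rw [Data.thresholds, Data.length_powers _ hi, Data.length_mul, Data.tail_cons,
        Data.tail_cons, Data.head_cons, Data.length_minLength]
      simp [hk']
    rw [Data.kernel, hkept, hd, Data.head_cons, Data.tail_cons, Data.tail_cons,
      Data.used_ofNatList]
  let I' : Instance r :=
    { univ := (us.filter fun a => ∃ S ∈ R, a ∈ S).reverse.toFinset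
      sets := F
      k := I.k
      subset_univ := fun S hS a ha => by
        rw [List.mem_toFinset, List.mem_reverse, hU]
        exact ⟨S, hS, ha⟩
      card_le := fun S hS => I.card_le S (hFI hS) }
  refine ⟨I', Data.kernel r d, n, ⟨s, he, hs⟩, hn, ?_, ?_, rfl, ?_, ?_⟩
  · exact ⟨_, R, List.nodup_reverse.2 (hus.filter _), rfl, fun S hS => hssn S (hRss S hS), hRn,
      rfl, hkern⟩
  · rw [Instance.hasMembership_iff, Instance.hasMembership_iff]
    constructor
    · rintro ⟨K, hK, hk, hKt⟩
      -- A solution with `I.k` sets shows that `I.k` is at most the number of sets, so the minimum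
      -- is `I.k`.
      have hkk : #K = k' := by
        have : #I.sets = ss.length := by
          rw [← hssI, List.toFinset_card_of_nodup hssd, List.length_map]
        have := card_le_card hK
        omega
      obtain ⟨K', hK', hk₁, hKt'⟩ :=
        exists_subset_of_saturated ht hFI I.card_le hle hsat K hK hkk hKt
      exact ⟨K', hK', by rw [hk₁, ← hkk, hk], hKt'⟩
    · rintro ⟨K, hK, hk, hKt⟩
      exact ⟨K, hK.trans hFI, hk, hKt⟩
  · intro a ha
    rw [List.mem_toFinset, List.mem_reverse] at ha
    rw [← husI, List.mem_toFinset]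
    exact List.mem_of_mem_filter ha
  -- All kept sets include `∅`, so its bound counts them all.
  · have hFc : #F ≤ ((r + 1) * k') ^ r := by simpa using hle ∅
    have hsub : I'.univ ⊆ F.biUnion id := fun a ha => by
      rw [List.mem_toFinset, List.mem_reverse, hU] at ha
      simpa using ha
    calc #I'.univ ≤ #F * r :=
          (card_le_card hsub).trans
            (card_biUnion_le_card_mul _ _ _ fun S hS => I.card_le S (hFI hS))
      _ ≤ ((r + 1) * k') ^ r * r := Nat.mul_le_mul_right _ hFc
      _ = r * ((r + 1) * k') ^ r := mul_comm _ _
      _ ≤ _ := mul_pow_le_factorial (min_le_left _ _)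

end SetPacking

theorem mainTheorem2 (r t : ℕ) (hr : 1 ≤ r) (ht : 1 ≤ t) :
    SetPacking.HasKernel r t
      (fun k => 2 * Nat.factorial r * ((r + 1) ^ r * k ^ r)) :=
  SetPacking.hasKernel r t ht
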